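/- For a positive integer $m$ and an integer $n\ge 0$, an $MH(n,m)$ is an $n\times n$ matrix $H$ with entries $\pm1$ such that $HH^{\top}\equiv nI \pmod m$. **Theorem.** Let $p$ be a prime such that $2$ is a primitive root modulo $p$ and such that $p\equiv 2^i+1 \pmod{2^{i+1}}$ for some integer $i\ge 1$. Assume that for every integer $\delta$ with $1\le\delta<p$ there exist an odd prime power $q\equiv 1\pmod p$ and a positive integer $d\equiv\delta\pmod p$ such that $r=\frac{q^d-1}{q-1}$ is a prime power with $r\equiv 1\pmod 4$. (A prime power is a number $\ell^k$ with $\ell$ prime and $k\ge1$.) Let $0\le j\le i$. Then for all but finitely many non-negative integers $n$ the following holds: if $n$ is not divisible by $p$, if $4n^{-1}\equiv a^{2^j}\pmod p$ for some integer $a$, and if $2^{i-j}$ divides $n$, then an $MH(n,p)$ exists. -/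

import Mathlib

open scoped Matrix

/-- `H` is an `m`-modular Hadamard matrix of size `n`, i.e. an `MH(n, m)`: an `n × n` matrix with
entries `±1` such that `H * Hᵀ ≡ n I (mod m)` entrywise. -/
def IsModularHadamard (n m : ℕ) (H : Matrix (Fin n) (Fin n) ℤ) : Prop :=
  (∀ s t, H s t = 1 ∨ H s t = -1) ∧
    ∀ s t, (H * Hᵀ) s t ≡ ((n : ℤ) • (1 : Matrix (Fin n) (Fin n) ℤ)) s t [ZMOD (m : ℤ)]

/-- An `MH(n, m)` exists. -/
def ExistsMH (n m : ℕ) : Prop :=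
  ∃ H : Matrix (Fin n) (Fin n) ℤ, IsModularHadamard n m H

/-- For every `1 ≤ δ < p` there are an odd prime power `q ≡ 1 (mod p)` and an exponent
`d ≡ δ (mod p)` such that `r = (q ^ d - 1) / (q - 1)` is a prime power with `r ≡ 1 (mod 4)`.
(The division of natural numbers is exact here, as `q - 1` divides `q ^ d - 1`.) -/
def PrimePowerCondition (p : ℕ) : Prop :=
  ∀ δ : ℕ, 1 ≤ δ → δ < p →
    ∃ q d r : ℕ, IsPrimePow q ∧ Odd q ∧ q ≡ 1 [MOD p] ∧ d ≡ δ [MOD p] ∧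
      r = (q ^ d - 1) / (q - 1) ∧ IsPrimePow r ∧ r ≡ 1 [MOD 4]

/-!
Let `δ = 4 / n` in `ZMod p`, so that `δ` is a `2 ^ j`-th power. If `δ = 1`, then `n ≡ 4 (mod p)` and
`J - 2I` is an `MH(n, p)`. The other classes rest on two constructions.

*Replacing points by blocks* (`ExistsMH.sum_of_existsPointBlock`). Let `H` be an `MH(n₀, p)` and let
`M` be a `±1` matrix whose size and row sums are `1` modulo `p` and whose distinct rows have inner
product `1 - n₀`. Modulo `p` the matrix `M` cannot be told from the `1 × 1` matrix `1`, so that any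
number `s ≤ n₀` of diagonal entries of `H` may be replaced by signed copies of `M`, the other entries in
these rows and columns by constant blocks. This gives an `MH(n₀ + s (v - 1), p)`, where `v` is the
size of `M`.

*A symmetric design* (`exists_symmetricDesign`). If `q` and `r = (q ^ d - 1) / (q - 1)` are prime
powers, there is a symmetric design with
`v = 1 + q r (r ^ m - 1) / (r - 1)`, `k = r ^ m`, `λ = r ^ (m - 1) (r - 1) / q`. It is assembled from
the hyperplanes of a projective space over the field with `r` elements, with incidences that carry
values in a cyclic quotient of order `q` of the multiplicative group of that field, and from the values
of the linear forms on a space over the field with `q` elements. That `r` is both a prime power and the number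
of points of a projective space over the second field links the two. All the inner products reduce to
counts of points on one hyperplane or on two (`card_dual_points_ratio` and its companions).

Take `q ≡ 1`, `r ≡ d ≡ δ (mod p)` and `m = (p - 1) / 2 ^ j`. As `δ` is a `2 ^ j`-th power, `δ ^ m = 1`, so
the parameters are `(1, 1, 1 - δ⁻¹)` modulo `p`, and `M = 2A - J` is a block for sizes
`n₀ ≡ 4 / δ ≡ n`. Since `r ≡ 1 (mod 4)`, the number `v - 1` is `2 ^ (i - j)` times an odd number; it is
also divisible by `p`. As `2` is a primitive root, `δ⁻¹ = 2 ^ t` for some `t`, and the Kronecker product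
of a Sylvester matrix of order `2 ^ t` with `J - 2I` of order `M' ≡ 4` is an `MH(2 ^ t M', p)`. If
`2 ^ (i - j)` divides `n`, some `s < 2 ^ t` makes `n - s (v - 1)` divisible by `2 ^ t`. For large `n` this
number is of the form `2 ^ t M'`, and inserting `s` blocks leads to size `n`. Only finitely many `δ` occur,
so one bound serves for all.
-/

/-! ### Elementary modular Hadamard matrices -/

/-- Reindexing: rows and columns may be labelled by any two types with `n` elements, and only
distinct rows have to be tested, since every `±1` row has squared norm `n`. -/
lemma existsMH_of_orthogonal {α β : Type*} [Fintype α] [Fintype β] {n p : ℕ}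
    (hα : Fintype.card α = n) (hβ : Fintype.card β = n) (A : α → β → ℤ)
    (hA : ∀ s t, A s t = 1 ∨ A s t = -1)
    (h : ∀ s t, s ≠ t → ((∑ k, A s k * A t k : ℤ) : ZMod p) = 0) : ExistsMH n p := by
  classical
  let e : Fin n ≃ α := (Fintype.equivFinOfCardEq hα).symm
  let f : Fin n ≃ β := (Fintype.equivFinOfCardEq hβ).symm
  refine ⟨Matrix.of fun s t => A (e s) (f t), fun s t => hA _ _, fun s t => ?_⟩
  rw [← ZMod.intCast_eq_intCast_iff]
  have hs : ((Matrix.of fun s t => A (e s) (f t)) * (Matrix.of fun s t => A (e s) (f t))ᵀ) s t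
      = ∑ k, A (e s) k * A (e t) k := by
    simp only [Matrix.mul_apply, Matrix.transpose_apply, Matrix.of_apply]
    exact f.sum_comp fun k => A (e s) k * A (e t) k
  rw [hs]
  by_cases hst : s = t
  · subst hst
    have h1 : ∀ k, A (e s) k * A (e s) k = 1 := fun k => by
      rcases hA (e s) k with h | h <;> simp [h]
    simp [h1, hβ]
  · rw [h _ _ (fun hh => hst (e.injective hh))]
    simp [Matrix.one_apply_ne hst]

/-- The rows of an `MH(n, p)` are orthogonal modulo `p`. -/
lemma IsModularHadamard.sum_mul_eq {n p : ℕ} {H : Matrix (Fin n) (Fin n) ℤ}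
    (hH : IsModularHadamard n p H) {s t : Fin n} (hst : s ≠ t) :
    ((∑ k, H s k * H t k : ℤ) : ZMod p) = 0 := by
  have h := hH.2 s t
  rw [← ZMod.intCast_eq_intCast_iff, Matrix.mul_apply] at h
  simpa [Matrix.one_apply_ne hst] using h

/-- If `n ≡ 4 (mod p)`, then `J - 2I` is an `MH(n, p)`: two of its rows have inner product
`n - 4`. -/
lemma existsMH_of_cast_eq_four {n p : ℕ} (h : (n : ZMod p) = 4) : ExistsMH n p := by
  refine existsMH_of_orthogonal (α := Fin n) (β := Fin n) (by simp) (by simp)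
    (fun s t => 1 - 2 * if s = t then 1 else 0) (fun s t => ?_) (fun s t hst => ?_)
  · by_cases h : s = t <;> simp [h]
  · have h1 : ∀ k : Fin n, (1 - 2 * if s = k then (1 : ℤ) else 0) * (1 - 2 * if t = k then 1 else 0)
        = 1 - 2 * (if s = k then 1 else 0) - 2 * (if t = k then 1 else 0) := fun k => by
      by_cases hs : s = k <;> by_cases ht : t = k <;> simp_all
    simp_rw [h1, Finset.sum_sub_distrib, ← Finset.mul_sum]
    simp [h]
    ring

/-- Sylvester's doubling. -/
lemma ExistsMH.two_mul {n p : ℕ} (h : ExistsMH n p) : ExistsMH (2 * n) p := by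
  obtain ⟨H, hH⟩ := h
  refine existsMH_of_orthogonal (α := Bool × Fin n) (β := Bool × Fin n) (by simp) (by simp)
    (fun s t => (if s.1 && t.1 then -1 else 1) * H s.2 t.2) (fun s t => ?_) ?_
  · rcases hH.1 s.2 t.2 with h | h <;> rw [h] <;> split_ifs <;> simp
  · rintro ⟨a, s⟩ ⟨b, t⟩ hst
    rw [Fintype.sum_prod_type]
    by_cases hs : s = t
    · subst hs
      have hab : a ≠ b := fun h => hst (by rw [h])
      cases a <;> cases b <;> simp_all
    · have := hH.sum_mul_eq hs
      cases a <;> cases b <;> simp_all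

lemma ExistsMH.two_pow_mul {n p : ℕ} (h : ExistsMH n p) (t : ℕ) : ExistsMH (2 ^ t * n) p := by
  induction t with
  | zero => simpa using h
  | succ t ih => rw [pow_succ', mul_assoc]; exact ih.two_mul

/-! ### Replacing points by blocks -/

/-- A `v × v` matrix with entries `±1` by which a point of an `MH(n, p)` with `n ≡ κ (mod p)` may
be replaced: modulo `p`, its size and its row sums are `1`, and its distinct rows have inner product
`1 - κ`. -/
def ExistsPointBlock (p : ℕ) (κ : ZMod p) (v : ℕ) : Prop :=
  (v : ZMod p) = 1 ∧ ∃ M : Fin v → Fin v → ℤ, (∀ s t, M s t = 1 ∨ M s t = -1) ∧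
    (∀ s, ((∑ k, M s k : ℤ) : ZMod p) = 1) ∧
    ∀ s t, s ≠ t → ((∑ k, M s k * M t k : ℤ) : ZMod p) = 1 - κ

lemma existsPointBlock_one (p : ℕ) (κ : ZMod p) : ExistsPointBlock p κ 1 :=
  ⟨by simp, fun _ _ => 1, by simp, by simp, fun s t h => (h (Subsingleton.elim s t)).elim⟩

/-- In an `MH(n, p)`, replace the diagonal entries `h a a` by blocks `h a a • M a` and the other
entries `h a b` by constant blocks. As the sizes and the row sums of the `M a` are `1` modulo `p`, rows
from different blocks stay orthogonal; two rows of `M a` have inner product `1 - n`, and the other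
blocks contribute the missing `n - 1`. -/
lemma ExistsMH.sum_of_existsPointBlock {n p : ℕ} (h : ExistsMH n p) {v : Fin n → ℕ}
    (hv : ∀ a, ExistsPointBlock p n (v a)) : ExistsMH (∑ a, v a) p := by
  classical
  obtain ⟨H, hH⟩ := h
  choose hv1 M hM hsum hinner using hv
  -- the row of the block `a` that is indexed by `s`, restricted to the columns of the block `b`
  let T : (a : Fin n) → Fin (v a) → (b : Fin n) → Fin (v b) → ℤ := fun a s b k =>
    if hab : a = b then H a b * M b (hab ▸ s) k else H a b
  have Tself : ∀ a s k, T a s a k = H a a * M a s k := fun a s k => by simp [T]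
  have Tne : ∀ a s b k, a ≠ b → T a s b k = H a b := fun a s b k hab => by simp [T, hab]
  have hHsq : ∀ a b, (H a b : ZMod p) * H a b = 1 := fun a b => by
    rcases hH.1 a b with h | h <;> simp [h]
  refine existsMH_of_orthogonal (α := Σ a, Fin (v a)) (β := Σ a, Fin (v a)) (by simp) (by simp)
    (fun x y => T x.1 x.2 y.1 y.2) ?_ ?_
  · rintro ⟨a, s⟩ ⟨b, k⟩
    by_cases hab : a = b
    · subst hab
      simp only [Tself]
      rcases hH.1 a a with h | h <;> rcases hM a s k with h' | h' <;> simp [h, h']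
    · simpa only [Tne a s b k hab] using hH.1 a b
  · rintro ⟨a, s⟩ ⟨b, t⟩ hne
    rw [Fintype.sum_sigma]
    push_cast
    by_cases hab : a = b
    · subst hab
      have hst : s ≠ t := fun h => hne (by rw [h])
      have key : ∀ c, ∑ k, (T a s c k : ZMod p) * T a t c k
          = 1 - if c = a then (n : ZMod p) else 0 := fun c => by
        by_cases hc : c = a
        · subst hc
          have := hinner c s t hst
          push_cast at this
          simp only [Tself, Int.cast_mul, if_true, ← this]
          refine Finset.sum_congr rfl fun k _ => ?_
          linear_combination (M c s k * M c t k : ZMod p) * hHsq c c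
        · simp [Tne _ _ _ _ (Ne.symm hc), hHsq, hc, hv1]
      simp only [key, Finset.sum_sub_distrib]
      simp
    · have key : ∀ c, ∑ k, (T a s c k : ZMod p) * T b t c k = (H a c : ZMod p) * H b c := fun c => by
        by_cases hca : c = a
        · subst hca
          have := hsum c s
          push_cast at this
          simp only [Tself, Tne _ _ _ _ (Ne.symm hab), Int.cast_mul]
          rw [← Finset.sum_mul, ← Finset.mul_sum, this, mul_one]
        · by_cases hcb : c = b
          · subst hcb
            have := hsum c t
            push_cast at this
            simp only [Tself, Tne _ _ _ _ hab, Int.cast_mul]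
            rw [← Finset.mul_sum, ← Finset.mul_sum, this, mul_one]
          · simp [Tne _ _ _ _ (Ne.symm hca), Tne _ _ _ _ (Ne.symm hcb), hv1]
      have := hH.sum_mul_eq hab
      push_cast at this
      simpa only [key] using this

lemma ExistsMH.add_mul_of_existsPointBlock {n p s w : ℕ} (h : ExistsMH n p)
    (hw : ExistsPointBlock p n (w + 1)) (hs : s ≤ n) : ExistsMH (n + s * w) p := by
  have := h.sum_of_existsPointBlock (v := fun a => if (a : ℕ) < s then w + 1 else 1) fun a => by
    split_ifs
    exacts [hw, existsPointBlock_one p _]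
  have hcard : ∑ a : Fin n, (if (a : ℕ) < s then w + 1 else 1) = n + s * w := by
    have h1 : ∀ a : ℕ, (if a < s then w + 1 else 1) = (if a < s then w else 0) + 1 := fun a => by
      split_ifs <;> simp
    rw [Fin.sum_univ_eq_sum_range (fun a => if a < s then w + 1 else 1)]
    simp only [h1, Finset.sum_add_distrib, ← Finset.sum_filter]
    have h2 : (Finset.range n).filter (· < s) = Finset.range s := by
      ext a; simp; omega
    rw [h2]; simp; ring
  rwa [hcard] at this

/-! ### Counting points of the dual projective space -/

lemma linearIndependent_rep_pair {F W : Type*} [Field F] [AddCommGroup W] [Module F W]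
    {x y : Projectivization F W} (h : x ≠ y) :
    LinearIndependent F ![x.rep, y.rep] := by
  rw [← Projectivization.linearIndependent_pair_iff_ne] at h
  convert h using 1

section PointCount

open Module

variable {F W : Type*} [Field F] [Fintype F] [AddCommGroup W] [Module F W]

lemma card_projectivization_rep_mem {n : ℕ} (S : Submodule F W) (hS : finrank F S = n) :
    Nat.card {j : Projectivization F W // j.rep ∈ S} =
      ∑ k ∈ Finset.range n, Fintype.card F ^ k := by
  rw [← Nat.card_eq_fintype_card, ← Projectivization.card_of_finrank F S hS]
  have hmem (x : Projectivization F S) :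
      (Projectivization.map S.subtype S.injective_subtype x).rep ∈ S := by
    induction x using Projectivization.ind with
    | h v hv =>
      rw [Projectivization.map_mk]
      obtain ⟨a, ha⟩ := Projectivization.exists_smul_eq_mk_rep F (S.subtype v)
        (fun h => hv (S.injective_subtype (by simpa using h)))
      rw [← ha]
      exact S.smul_mem (a : F) v.2
  refine (Nat.card_congr (Equiv.ofBijective
    (fun x : Projectivization F S => (⟨_, hmem x⟩ : {j : Projectivization F W // j.rep ∈ S}))
    ⟨fun x y h => ?_, fun x => ?_⟩)).symm
  · exact Projectivization.map_injective S.subtype S.injective_subtype (congrArg Subtype.val h)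
  · refine ⟨Projectivization.mk F ⟨x.1.rep, x.2⟩
      (fun h => x.1.rep_nonzero (congrArg Subtype.val h)), Subtype.ext ?_⟩
    dsimp only
    rw [Projectivization.map_mk]
    exact x.1.mk_rep

variable [Fintype (Projectivization F (Dual F W))]

lemma card_dual_points {n : ℕ} (hn : finrank F W = n) :
    Fintype.card (Projectivization F (Dual F W)) = ∑ k ∈ Finset.range n, Fintype.card F ^ k := by
  rw [← Nat.card_eq_fintype_card, ← Nat.card_eq_fintype_card]
  exact Projectivization.card_of_finrank F _ (by rw [Subspace.dual_finrank_eq, hn])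

variable [FiniteDimensional F W]

open scoped Classical in
lemma card_dual_points_vanishing {n : ℕ} (S : Submodule F W)
    (hS : finrank F S + n = finrank F W) :
    (Finset.univ.filter fun j : Projectivization F (Dual F W) => ∀ w ∈ S, j.rep w = 0).card =
      ∑ k ∈ Finset.range n, Fintype.card F ^ k := by
  have h := Subspace.finrank_add_finrank_dualAnnihilator_eq S
  rw [← card_projectivization_rep_mem S.dualAnnihilator (n := n) (by omega),
    Nat.card_eq_fintype_card, Fintype.card_subtype]
  simp only [Submodule.mem_dualAnnihilator]

open scoped Classical in
lemma card_dual_points_eq_zero {n : ℕ} (hn : finrank F W = n + 1) {w : W} (hw : w ≠ 0) :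
    (Finset.univ.filter fun j : Projectivization F (Dual F W) => j.rep w = 0).card =
      ∑ k ∈ Finset.range n, Fintype.card F ^ k := by
  rw [← card_dual_points_vanishing (Submodule.span F {w})
    (by rw [finrank_span_singleton hw, hn, add_comm])]
  congr 1
  ext j
  simp only [Finset.mem_filter, Finset.mem_univ, true_and, Submodule.mem_span_singleton]
  exact ⟨by rintro h _ ⟨a, rfl⟩; simp [h], fun h => h w ⟨1, one_smul _ _⟩⟩

open scoped Classical in
lemma card_dual_points_ne_zero {n : ℕ} (hn : finrank F W = n + 1) {w : W} (hw : w ≠ 0) :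
    (Finset.univ.filter fun j : Projectivization F (Dual F W) => j.rep w ≠ 0).card =
      Fintype.card F ^ n := by
  have h1 := Finset.card_filter_add_card_filter_not (s := Finset.univ)
    (fun j : Projectivization F (Dual F W) => j.rep w = 0)
  rw [card_dual_points_eq_zero hn hw, Finset.card_univ, card_dual_points hn,
    Finset.sum_range_succ] at h1
  exact Nat.add_left_cancel h1

open scoped Classical in
lemma card_dual_points_eq_zero_and {n : ℕ} (hn : finrank F W = n + 2) {w w' : W}
    (hw : LinearIndependent F ![w, w']) :
    (Finset.univ.filter fun j : Projectivization F (Dual F W) =>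
      j.rep w = 0 ∧ j.rep w' = 0).card = ∑ k ∈ Finset.range n, Fintype.card F ^ k := by
  have h2 : finrank F (Submodule.span F {w, w'}) = 2 := by
    have := finrank_span_eq_card hw
    rwa [Matrix.range_cons_cons_empty, Fintype.card_fin] at this
  rw [← card_dual_points_vanishing (Submodule.span F {w, w'}) (by rw [h2, hn, add_comm])]
  congr 1
  ext j
  simp only [Finset.mem_filter, Finset.mem_univ, true_and, Submodule.mem_span_pair]
  constructor
  · rintro ⟨h, h'⟩ _ ⟨a, b, rfl⟩
    simp [h, h']
  · exact fun h => ⟨h w ⟨1, 0, by simp⟩, h w' ⟨0, 1, by simp⟩⟩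

open scoped Classical in
/-- For independent `w` and `w'`, the ratio `j w / j w'` takes every value at equally many
points `j`: these are the points on the hyperplane of `w - t • w'` that are not on both of the
hyperplanes of `w` and of `w'`. -/
lemma card_dual_points_ratio {n : ℕ} (hn : finrank F W = n + 2) {w w' : W}
    (hw : LinearIndependent F ![w, w']) (t : F) :
    (Finset.univ.filter fun j : Projectivization F (Dual F W) =>
      j.rep w' ≠ 0 ∧ j.rep w = t * j.rep w').card = Fintype.card F ^ n := by
  have hne : w - t • w' ≠ 0 := fun h => by
    have := LinearIndependent.pair_iff.1 hw 1 (-t) (by rw [← h]; module)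
    simp at this
  have h1 := Finset.card_filter_add_card_filter_not
    (s := Finset.univ.filter fun j : Projectivization F (Dual F W) => j.rep (w - t • w') = 0)
    (fun j => j.rep w = 0 ∧ j.rep w' = 0)
  rw [Finset.filter_filter, Finset.filter_filter, card_dual_points_eq_zero hn hne,
    Finset.sum_range_succ] at h1
  have h2 : (Finset.univ.filter fun j : Projectivization F (Dual F W) =>
      j.rep (w - t • w') = 0 ∧ j.rep w = 0 ∧ j.rep w' = 0) =
      Finset.univ.filter fun j => j.rep w = 0 ∧ j.rep w' = 0 := by
    ext j; simp +contextual
  have h3 : (Finset.univ.filter fun j : Projectivization F (Dual F W) =>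
      j.rep (w - t • w') = 0 ∧ ¬(j.rep w = 0 ∧ j.rep w' = 0)) =
      Finset.univ.filter fun j => j.rep w' ≠ 0 ∧ j.rep w = t * j.rep w' := by
    ext j
    simp only [Finset.mem_filter, Finset.mem_univ, true_and, map_sub, map_smul, smul_eq_mul,
      sub_eq_zero, ne_eq]
    constructor
    · exact fun ⟨h, h'⟩ => ⟨fun h0 => h' ⟨by rw [h, h0, mul_zero], h0⟩, h⟩
    · exact fun ⟨h, h'⟩ => ⟨h', fun h0 => h h0.2⟩
  rw [h2, h3, card_dual_points_eq_zero_and hn hw] at h1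
  exact Nat.add_left_cancel h1

end PointCount

/-! ### A cyclic quotient of the multiplicative group -/

open scoped Classical in
/-- A homomorphism `χ` from the multiplicative group of a finite field onto `ZMod q`, extended to `0` by
a value that plays no role: the group is cyclic of order `q * k`, so that every fibre has `k`
elements. -/
lemma exists_equidistributed_log {L : Type*} [Field L] [Fintype L] {q k : ℕ} (hq : 0 < q)
    (hL : Fintype.card L = q * k + 1) :
    ∃ χ : L → ZMod q, (∀ s t, s ≠ 0 → t ≠ 0 → χ (s * t) = χ s + χ t) ∧
      ∀ g, (Finset.univ.filter fun t => t ≠ 0 ∧ χ t = g).card = k := by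
  have : NeZero q := ⟨hq.ne'⟩
  have hcard : Nat.card Lˣ = q * k := by
    rw [Nat.card_eq_fintype_card, Fintype.card_units, hL, Nat.add_sub_cancel]
  have hdvd : q ∣ Nat.card Lˣ := ⟨k, hcard⟩
  let f : Lˣ →* Multiplicative (ZMod q) :=
    (AddMonoidHom.toMultiplicative
      (ZMod.castHom hdvd (ZMod q)).toAddMonoidHom).comp
      (zmodCyclicMulEquiv (G := Lˣ) inferInstance).symm.toMonoidHom
  have hf : Function.Surjective f :=
    (ZMod.castHom_surjective hdvd).comp
      (zmodCyclicMulEquiv (G := Lˣ) inferInstance).symm.surjective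
  have hfib : ∀ g, (Finset.univ.filter fun u => f u = g).card = k := fun g => by
    have h1 : ∀ g' ∈ (Finset.univ : Finset (Multiplicative (ZMod q))),
        (Finset.univ.filter fun u => f u = g').card = (Finset.univ.filter fun u => f u = g).card :=
      fun g' _ => MonoidHom.card_fiber_eq_of_mem_range f (hf g') (hf g)
    have h2 := Finset.card_eq_sum_card_fiberwise (f := f) (s := Finset.univ) (t := Finset.univ)
      (fun _ _ => Finset.mem_coe.2 (Finset.mem_univ _))
    rw [Finset.sum_congr rfl h1, Finset.sum_const, Finset.card_univ, Finset.card_univ,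
      ← Nat.card_eq_fintype_card, hcard, Fintype.card_multiplicative, ZMod.card, smul_eq_mul] at h2
    exact (Nat.eq_of_mul_eq_mul_left hq h2).symm
  let χ : L → ZMod q := fun t => if h : t = 0 then 0 else (f (Units.mk0 t h)).toAdd
  have hχ : ∀ u : Lˣ, χ u = (f u).toAdd := fun u => by simp [χ]
  refine ⟨χ, fun s t hs ht => ?_, fun g => ?_⟩
  · lift s to Lˣ using hs.isUnit
    lift t to Lˣ using ht.isUnit
    rw [← Units.val_mul, hχ, hχ, hχ, map_mul, toAdd_mul]
  · rw [← hfib (Multiplicative.ofAdd g)]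
    symm
    refine Finset.card_bij (fun u _ => (u : L)) (fun u hu => ?_) (fun u _ u' _ h => Units.ext h)
      (fun t ht => ?_)
    · rw [Finset.mem_filter] at hu
      simp [hχ, hu.2]
    · rw [Finset.mem_filter] at ht
      lift t to Lˣ using ht.2.1.isUnit
      refine ⟨t, ?_, rfl⟩
      rw [Finset.mem_filter, ← ht.2.2, hχ]
      simp

/-! ### A symmetric design -/

section Design

open Module
open scoped LinearAlgebra.Projectivization

variable {K L V U : Type*} [Field K] [Field L] [AddCommGroup V] [Module K V] [AddCommGroup U]
  [Module L U] {q : ℕ}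

open scoped Classical in
/-- The incidence matrix of the design. The columns other than `none` are the triples `(j, φ, g)` of
a point `j` of `ℙ(U*)`, a point `φ` of `ℙ(V*)` and a letter `g`. Points of projective
spaces are represented by their vectors `rep`.
A row `(i, x)` reads, in front of `(j, φ)`, the letter `φ x` (encoded by `e`) shifted by the logarithm
`χ` of `j i`; it is zero there when `j i = 0`.
A row `y` does not depend on `g`: it is the incidence of `φ` with the point of `ℙ(V)` that `θ`
attaches to the value `j y`. -/
noncomputable def incidence (χ : L → ZMod q) (e : K → ZMod q) (θ : L → ℙ K V) :
    (ℙ L U × V) ⊕ U → Option (ℙ L (Dual L U) × ℙ K (Dual K V) × ZMod q) → ℕ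
  | .inl _, none => 0
  | .inl (i, x), some (j, φ, g) =>
    (if j.rep i.rep ≠ 0 then 1 else 0) * if χ (j.rep i.rep) + e (φ.rep x) = g then 1 else 0
  | .inr _, none => 1
  | .inr y, some (j, φ, _) => if φ.rep (θ (j.rep y)).rep = 0 then 1 else 0

variable {χ : L → ZMod q} {e : K → ZMod q} {θ : L → ℙ K V}

lemma incidence_eq (s : (ℙ L U × V) ⊕ U) (k) :
    incidence χ e θ s k = 0 ∨ incidence χ e θ s k = 1 := by
  rcases s with ⟨i, x⟩ | y <;> rcases k with _ | ⟨j, φ, g⟩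
  · exact Or.inl rfl
  · simp only [incidence, ite_zero_mul_ite_zero, mul_one]
    split_ifs <;> simp
  · exact Or.inr rfl
  · simp only [incidence]
    split_ifs <;> simp

variable [Fintype (ℙ K (Dual K V))] [Fintype (ℙ L (Dual L U))] [NeZero q]

open scoped Classical in
lemma sum_incidence_inl_mul_inl (i i' : ℙ L U) (x x' : V) :
    ∑ k, incidence χ e θ (.inl (i, x)) k * incidence χ e θ (.inl (i', x')) k =
      ∑ φ : ℙ K (Dual K V), (Finset.univ.filter fun j : ℙ L (Dual L U) =>
        (j.rep i.rep ≠ 0 ∧ j.rep i'.rep ≠ 0) ∧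
          χ (j.rep i.rep) + e (φ.rep x) = χ (j.rep i'.rep) + e (φ.rep x')).card := by
  have h : ∀ (a b : ℕ) (c d : ZMod q),
      ∑ g, (a * if c = g then 1 else 0) * (b * if d = g then 1 else 0) =
        a * b * if c = d then 1 else 0 := fun a b c d => by
    simp_rw [mul_mul_mul_comm, ← Finset.mul_sum]
    simp
  rw [Fintype.sum_option, Fintype.sum_prod_type]
  simp_rw [Fintype.sum_prod_type]
  rw [Finset.sum_comm]
  refine (zero_add _).trans (Finset.sum_congr rfl fun φ _ => ?_)
  rw [Finset.card_filter]
  refine Finset.sum_congr rfl fun j _ => ?_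
  simp only [incidence]
  rw [h, ite_zero_mul_ite_zero, ite_zero_mul_ite_zero, mul_one, mul_one]

variable [Fintype L]

lemma sum_incidence_inl [FiniteDimensional L U] {N : ℕ} (hU : finrank L U = N + 1) (i : ℙ L U) (x : V) :
    ∑ k, incidence χ e θ (.inl (i, x)) k =
      Fintype.card L ^ N * Fintype.card (ℙ K (Dual K V)) := by
  classical
  have h : ∀ (j : ℙ L (Dual L U)) (φ : ℙ K (Dual K V)),
      ∑ g, incidence χ e θ (.inl (i, x)) (some (j, φ, g)) = if j.rep i.rep ≠ 0 then 1 else 0 :=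
    fun j φ => by simp only [incidence, ← Finset.mul_sum]; simp
  simp only [Fintype.sum_option, Fintype.sum_prod_type, h, Finset.sum_const, ← Finset.smul_sum,
    ← Finset.card_filter, card_dual_points_ne_zero hU i.rep_nonzero]
  simp [incidence, mul_comm]

lemma sum_incidence_inl_mul_inl_of_ne [FiniteDimensional L U] {k₀ N : ℕ}
    (hU : finrank L U = N + 2)
    (hχ : ∀ s t, s ≠ 0 → t ≠ 0 → χ (s * t) = χ s + χ t)
    (hχ' : ∀ g, Nat.card {t // t ≠ 0 ∧ χ t = g} = k₀)
    {i i' : ℙ L U} (hi : i ≠ i') (x x' : V) :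
    ∑ k, incidence χ e θ (.inl (i, x)) k * incidence χ e θ (.inl (i', x')) k =
      Fintype.card (ℙ K (Dual K V)) * (k₀ * Fintype.card L ^ N) := by
  classical
  rw [sum_incidence_inl_mul_inl, Finset.sum_congr rfl, Finset.sum_const,
    smul_eq_mul, Finset.card_univ]
  intro φ _
  -- the points `j` are sorted by the ratio `t = j i / j i'`, whose logarithm is prescribed
  rw [Finset.card_eq_sum_card_fiberwise
    (f := fun j : ℙ L (Dual L U) => j.rep i.rep / j.rep i'.rep)
    (t := Finset.univ.filter fun t => t ≠ 0 ∧ χ t = e (φ.rep x') - e (φ.rep x)),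
    Finset.sum_congr rfl, Finset.sum_const, smul_eq_mul,
    ← hχ' (e (φ.rep x') - e (φ.rep x)), Nat.card_eq_fintype_card, Fintype.card_subtype]
  · intro t ht
    rw [Finset.mem_filter] at ht
    rw [← card_dual_points_ratio hU (linearIndependent_rep_pair hi) t, Finset.filter_filter]
    congr 1
    ext j
    simp only [Finset.mem_filter, Finset.mem_univ, true_and]
    constructor
    · rintro ⟨⟨⟨_, h⟩, _⟩, rfl⟩
      exact ⟨h, (div_mul_cancel₀ _ h).symm⟩
    · rintro ⟨h, h'⟩
      refine ⟨⟨⟨h' ▸ mul_ne_zero ht.2.1 h, h⟩, ?_⟩, by rw [h', mul_div_cancel_right₀ _ h]⟩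
      rw [h', hχ _ _ ht.2.1 h, ht.2.2]
      abel
  · intro j hj
    simp only [Finset.coe_filter, Finset.mem_univ, true_and, Set.mem_ofPred_eq] at hj ⊢
    obtain ⟨⟨h, h'⟩, h''⟩ := hj
    refine ⟨div_ne_zero h h', ?_⟩
    have := hχ _ _ (div_ne_zero h h') h'
    rw [div_mul_cancel₀ _ h'] at this
    rw [this] at h''
    linear_combination h''

variable [Fintype K] [FiniteDimensional K V]

lemma sum_incidence_inr {D N : ℕ} (hV : finrank K V = D + 1) (hU : finrank L U = N)
    (y : U) :
    ∑ k, incidence χ e θ (.inr y : (ℙ L U × V) ⊕ U) k =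
      1 + (∑ k ∈ Finset.range N, Fintype.card L ^ k) *
        (q * ∑ k ∈ Finset.range D, Fintype.card K ^ k) := by
  classical
  have h : ∀ j : ℙ L (Dual L U), ∑ φ : ℙ K (Dual K V), ∑ g,
      incidence χ e θ (.inr y : (ℙ L U × V) ⊕ U) (some (j, φ, g)) =
        q * ∑ k ∈ Finset.range D, Fintype.card K ^ k := fun j => by
    simp only [incidence, Finset.sum_const, smul_eq_mul, ← Finset.mul_sum, Finset.card_univ,
      ZMod.card]
    rw [← Finset.card_filter, card_dual_points_eq_zero hV (θ _).rep_nonzero]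
  simp only [Fintype.sum_option, Fintype.sum_prod_type, h, Finset.sum_const, Finset.card_univ,
    card_dual_points hU, smul_eq_mul]
  rfl

variable [FiniteDimensional L U]

lemma sum_incidence_inl_mul_inl_self {D N : ℕ} (hV : finrank K V = D + 1)
    (hU : finrank L U = N + 1) (he : Function.Injective e) (i : ℙ L U) {x x' : V} (hx : x ≠ x') :
    ∑ k, incidence χ e θ (.inl (i, x)) k * incidence χ e θ (.inl (i, x')) k =
      Fintype.card L ^ N * ∑ k ∈ Finset.range D, Fintype.card K ^ k := by
  classical
  have h : ∀ φ : ℙ K (Dual K V), (Finset.univ.filter fun j : ℙ L (Dual L U) =>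
      (j.rep i.rep ≠ 0 ∧ j.rep i.rep ≠ 0) ∧
        χ (j.rep i.rep) + e (φ.rep x) = χ (j.rep i.rep) + e (φ.rep x')).card =
      Fintype.card L ^ N * if φ.rep (x - x') = 0 then 1 else 0 := fun φ => by
    rw [map_sub, ← card_dual_points_ne_zero hU i.rep_nonzero]
    by_cases hφ : φ.rep x = φ.rep x' <;> simp [hφ, he.eq_iff, sub_eq_zero]
  rw [sum_incidence_inl_mul_inl, Finset.sum_congr rfl fun φ _ => h φ, ← Finset.mul_sum,
    ← Finset.card_filter, card_dual_points_eq_zero hV (sub_ne_zero.2 hx)]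

lemma sum_incidence_inl_mul_inr {D N : ℕ} (hV : finrank K V = D + 1)
    (hU : finrank L U = N + 1) (i : ℙ L U) (x : V) (y : U) :
    ∑ k, incidence χ e θ (.inl (i, x)) k * incidence χ e θ (.inr y) k =
      Fintype.card L ^ N * ∑ k ∈ Finset.range D, Fintype.card K ^ k := by
  classical
  have h : ∀ j : ℙ L (Dual L U), ∑ φ : ℙ K (Dual K V), ∑ g,
      incidence χ e θ (.inl (i, x)) (some (j, φ, g)) *
        incidence χ e θ (.inr y) (some (j, φ, g)) =
      (if j.rep i.rep ≠ 0 then 1 else 0) * ∑ k ∈ Finset.range D, Fintype.card K ^ k := fun j => by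
    rw [← card_dual_points_eq_zero hV (θ (j.rep y)).rep_nonzero, Finset.card_filter,
      Finset.mul_sum]
    refine Finset.sum_congr rfl fun φ _ => ?_
    simp only [incidence, mul_assoc, ← Finset.mul_sum, ← Finset.sum_mul]
    simp
  simp only [Fintype.sum_option, Fintype.sum_prod_type, h]
  rw [← Finset.sum_mul, ← Finset.card_filter, card_dual_points_ne_zero hU i.rep_nonzero]
  simp [incidence]

/-- In front of `j`, the rows `y` and `y'` are the incidences of the same point of `ℙ(V)` if
`j (y - y') = 0`, and of two distinct points otherwise. -/
lemma sum_incidence_inr_mul_inr {D N : ℕ} (hV : finrank K V = D + 2)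
    (hU : finrank L U = N + 1) (hθ : Function.Injective θ) {y y' : U} (hy : y ≠ y') :
    ∑ k, incidence χ e θ (.inr y : (ℙ L U × V) ⊕ U) k * incidence χ e θ (.inr y') k =
      1 + ((∑ k ∈ Finset.range N, Fintype.card L ^ k) *
          (q * ∑ k ∈ Finset.range (D + 1), Fintype.card K ^ k) +
        Fintype.card L ^ N * (q * ∑ k ∈ Finset.range D, Fintype.card K ^ k)) := by
  classical
  have hj : ∀ j : ℙ L (Dual L U), ∑ φ : ℙ K (Dual K V), ∑ _g : ZMod q,
      (if φ.rep (θ (j.rep y)).rep = 0 then 1 else 0) *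
        (if φ.rep (θ (j.rep y')).rep = 0 then 1 else 0) =
      if j.rep (y - y') = 0 then q * ∑ k ∈ Finset.range (D + 1), Fintype.card K ^ k
      else q * ∑ k ∈ Finset.range D, Fintype.card K ^ k := fun j => by
    simp only [ite_zero_mul_ite_zero, mul_one, Finset.sum_const, smul_eq_mul,
      ← Finset.mul_sum, Finset.card_univ, ZMod.card, map_sub, sub_eq_zero]
    split_ifs with h
    · simp only [h, and_self]
      rw [← Finset.card_filter, card_dual_points_eq_zero hV (θ _).rep_nonzero]
    · rw [← Finset.card_filter, card_dual_points_eq_zero_and hV (linearIndependent_rep_pair (hθ.ne h))]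
  simp only [Fintype.sum_option, Fintype.sum_prod_type, incidence, mul_one, hj]
  rw [Finset.sum_ite, Finset.sum_const, Finset.sum_const,
    card_dual_points_eq_zero hU (sub_ne_zero.2 hy)]
  have := card_dual_points_ne_zero hU (sub_ne_zero.2 hy)
  simp only [ne_eq] at this
  rw [this, smul_eq_mul, smul_eq_mul]

end Design

/-- The symmetric design with parameters `(1 + q r (1 + r + ⋯ + r ^ (N + 1)), r ^ (N + 2),
r ^ (N + 1) (r - 1) / q)`, for prime powers `q` and `r = 1 + q + ⋯ + q ^ (D + 1)`. -/
theorem exists_symmetricDesign {q r D : ℕ} (hq : IsPrimePow q) (hr : IsPrimePow r)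
    (hqr : r = ∑ k ∈ Finset.range (D + 2), q ^ k) (N : ℕ) {v : ℕ}
    (hv : v = q * r * (∑ k ∈ Finset.range (N + 2), r ^ k) + 1) :
    ∃ A : Fin v → Fin v → ℕ, (∀ s k, A s k = 0 ∨ A s k = 1) ∧
      (∀ s, ∑ k, A s k = r ^ (N + 2)) ∧
      ∀ s t, s ≠ t → ∑ k, A s k * A t k =
        r ^ (N + 1) * ∑ k ∈ Finset.range (D + 1), q ^ k := by
  classical
  have : NeZero q := ⟨hq.pos.ne'⟩
  have exists_field : ∀ n, IsPrimePow n →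
      ∃ (F : Type) (_ : Field F) (_ : Fintype F), Fintype.card F = n := fun n hn => by
    obtain ⟨inst⟩ : Nonempty (Field (Fin n)) := Fintype.nonempty_field_iff.2 (by simpa using hn)
    exact ⟨Fin n, inst, inferInstance, Fintype.card_fin n⟩
  obtain ⟨K, _, _, hK⟩ := exists_field q hq
  obtain ⟨L, _, _, hL⟩ := exists_field r hr
  have hg : r = q * (∑ k ∈ Finset.range (D + 1), q ^ k) + 1 := by rw [hqr, geom_sum_succ]
  have hN : ∀ n, q * (∑ k ∈ Finset.range (D + 1), q ^ k) * (∑ k ∈ Finset.range n, r ^ k) + 1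
      = r ^ n := fun n => by
    have := geom_sum_mul_add (q * ∑ k ∈ Finset.range (D + 1), q ^ k) n
    rwa [← hg, mul_comm] at this
  obtain ⟨χ, hχ, hχ'⟩ := exists_equidistributed_log hq.pos (hL.trans hg)
  have : Fintype (Projectivization K (Fin (D + 2) → K)) := Fintype.ofFinite _
  have : Fintype (Projectivization L (Fin (N + 2) → L)) := Fintype.ofFinite _
  have : Finite (Module.Dual K (Fin (D + 2) → K)) := Module.finite_of_finite K
  have : Finite (Module.Dual L (Fin (N + 2) → L)) := Module.finite_of_finite L
  have : Fintype (Projectivization K (Module.Dual K (Fin (D + 2) → K))) := Fintype.ofFinite _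
  have : Fintype (Projectivization L (Module.Dual L (Fin (N + 2) → L))) := Fintype.ofFinite _
  have hV : Module.finrank K (Fin (D + 2) → K) = D + 2 := by simp
  have hU : Module.finrank L (Fin (N + 2) → L) = N + 2 := by simp
  have hPV : Fintype.card (Projectivization K (Fin (D + 2) → K)) = r := by
    rw [hqr, ← hK, ← Nat.card_eq_fintype_card, ← Nat.card_eq_fintype_card (α := K)]
    exact Projectivization.card_of_finrank K _ hV
  have hPU : Fintype.card (Projectivization L (Fin (N + 2) → L)) =
      ∑ k ∈ Finset.range (N + 2), r ^ k := by
    rw [← hL, ← Nat.card_eq_fintype_card, ← Nat.card_eq_fintype_card (α := L)]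
    exact Projectivization.card_of_finrank L _ hU
  have hPV' := card_dual_points hV
  have hPU' := card_dual_points hU
  rw [hK, ← hqr] at hPV'
  rw [hL] at hPU'
  let e : K ≃ ZMod q := Fintype.equivOfCardEq (by rw [hK, ZMod.card])
  let θ : L ≃ Projectivization K (Fin (D + 2) → K) := Fintype.equivOfCardEq (by rw [hL, hPV])
  have hrows : Fintype.card ((Projectivization L (Fin (N + 2) → L) × (Fin (D + 2) → K)) ⊕
      (Fin (N + 2) → L)) = v := by
    have hqD := geom_sum_mul_add (q - 1) (D + 2)
    obtain ⟨q', rfl⟩ : ∃ q', q = q' + 1 := ⟨q - 1, (Nat.sub_add_cancel hq.pos).symm⟩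
    rw [Nat.add_sub_cancel, ← hqr] at hqD
    simp only [Fintype.card_sum, Fintype.card_prod, Fintype.card_fun, Fintype.card_fin, hPU, hK, hL]
    rw [hv, ← hqD, ← hN (N + 2)]
    generalize ∑ k ∈ Finset.range (N + 2), r ^ k = w
    rw [hg]
    ring
  have hcols : Fintype.card (Option (Projectivization L (Module.Dual L (Fin (N + 2) → L)) ×
      Projectivization K (Module.Dual K (Fin (D + 2) → K)) × ZMod q)) = v := by
    simp only [Fintype.card_option, Fintype.card_prod, hPU', hPV', ZMod.card, hv]
    ring
  have row : ∀ s : (Projectivization L (Fin (N + 2) → L) × (Fin (D + 2) → K)) ⊕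
      (Fin (N + 2) → L), ∑ k, incidence χ e θ s k = r ^ (N + 2) := by
    rintro (⟨i, x⟩ | y)
    · rw [sum_incidence_inl hU, hL, hPV']
      ring
    · rw [sum_incidence_inr hV hU, hL, hK, ← hN (N + 2)]
      ring
  have inner : ∀ s t : (Projectivization L (Fin (N + 2) → L) × (Fin (D + 2) → K)) ⊕
      (Fin (N + 2) → L), s ≠ t → ∑ k, incidence χ e θ s k * incidence χ e θ t k =
        r ^ (N + 1) * ∑ k ∈ Finset.range (D + 1), q ^ k := by
    rintro (⟨i, x⟩ | y) (⟨i', x'⟩ | y') hst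
    · by_cases hi : i = i'
      · subst hi
        rw [sum_incidence_inl_mul_inl_self hV hU e.injective i fun h => hst (by rw [h]), hL, hK]
      · rw [sum_incidence_inl_mul_inl_of_ne (k₀ := ∑ k ∈ Finset.range (D + 1), q ^ k) hU hχ
          (fun g => ?_) hi, hPV', hL]
        · ring
        · rw [Nat.card_eq_fintype_card, Fintype.card_subtype]
          convert hχ' g
    · rw [sum_incidence_inl_mul_inr hV hU, hL, hK]
    · simp_rw [mul_comm (incidence χ e θ (Sum.inr y) _)]
      rw [sum_incidence_inl_mul_inr hV hU, hL, hK]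
    · rw [sum_incidence_inr_mul_inr hV hU θ.injective fun h => hst (by rw [h]), hL, hK]
      -- the two summands after `1 +` are `r ^ (N + 1) - 1` and `r ^ (N + 1) (κ - 1)`, where `κ` is the
      -- number of hyperplanes through a point of `ℙ(V)`
      have h1 := hN (N + 1)
      have h2 : ∑ k ∈ Finset.range (D + 1), q ^ k = q * (∑ k ∈ Finset.range D, q ^ k) + 1 :=
        geom_sum_succ
      rw [h2] at h1 ⊢
      generalize ∑ k ∈ Finset.range D, q ^ k = c at h1 ⊢
      generalize ∑ k ∈ Finset.range (N + 1), r ^ k = w at h1 ⊢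
      rw [← h1]
      ring
  refine ⟨fun s k => incidence χ e θ ((Fintype.equivFinOfCardEq hrows).symm s)
    ((Fintype.equivFinOfCardEq hcols).symm k), fun s k => incidence_eq _ _, fun s => ?_,
    fun s t hst => ?_⟩
  · rw [← row ((Fintype.equivFinOfCardEq hrows).symm s)]
    exact (Fintype.equivFinOfCardEq hcols).symm.sum_comp fun k => incidence χ e θ _ k
  · rw [← inner _ _ ((Fintype.equivFinOfCardEq hrows).symm.injective.ne hst)]
    exact (Fintype.equivFinOfCardEq hcols).symm.sum_comp
      fun k => incidence χ e θ _ k * incidence χ e θ _ k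

/-! ### Geometric sums and powers of two -/

/-- For `r ≡ 1 (mod 4)`, the geometric sum with `2 ^ e * o` terms, `o` odd, is `2 ^ e` times an odd
number: doubling the number of terms from `n` multiplies the sum by `1 + r ^ n ≡ 2 (mod 4)`. -/
lemma exists_geom_sum_eq_two_pow_mul_odd {r o : ℕ} (hr : r ≡ 1 [MOD 4]) (ho : Odd o) (e : ℕ) :
    ∃ w, Odd w ∧ ∑ k ∈ Finset.range (2 ^ e * o), r ^ k = 2 ^ e * w := by
  have hr2 : Odd r := by rw [Nat.odd_iff]; unfold Nat.ModEq at hr; omega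
  induction e with
  | zero =>
    refine ⟨_, ?_, (one_mul _).symm⟩
    rw [Finset.odd_sum_iff_odd_card_odd]
    simpa [hr2.pow] using ho
  | succ e ih =>
    obtain ⟨w, hw, h⟩ := ih
    obtain ⟨u, hu⟩ : ∃ u, 1 + r ^ (2 ^ e * o) = 2 * (2 * u + 1) := by
      have : r ^ (2 ^ e * o) % 4 = 1 := by
        have := hr.pow (2 ^ e * o)
        rwa [one_pow] at this
      exact ⟨r ^ (2 ^ e * o) / 4, by omega⟩
    refine ⟨w * (2 * u + 1), hw.mul ⟨u, rfl⟩, ?_⟩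
    rw [pow_succ', mul_assoc, two_mul, Finset.sum_range_add]
    simp_rw [pow_add, ← Finset.mul_sum]
    rw [← one_add_mul, h, hu, mul_assoc 2]
    ring

/-! ### Existence for almost all sizes -/

/-- The matrix `2 A - J` for a suitable symmetric design `A` is a block that may replace points. Modulo
`p` the parameters of the design are `(1, 1, 1 - δ⁻¹)`, since `q = 1`, `r = δ` and `δ ^ (N + 2) = 1`. -/
lemma existsPointBlock_of_primePow {p q r d e o N : ℕ} [Fact p.Prime] {δ : ZMod p}
    (hq : IsPrimePow q) (hqo : Odd q) (hqp : (q : ZMod p) = 1) (hr : IsPrimePow r)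
    (hr4 : r ≡ 1 [MOD 4]) (hqr : r = ∑ k ∈ Finset.range d, q ^ k) (hd : (d : ZMod p) = δ)
    (hδ : δ ≠ 1) (hN : N + 2 = 2 ^ e * o) (ho : Odd o) (hδN : δ ^ (N + 2) = 1) :
    ∃ w, Odd w ∧ p ∣ 2 ^ e * w ∧ ExistsPointBlock p (4 * δ⁻¹) (2 ^ e * w + 1) := by
  obtain ⟨w, hw, hsum⟩ := exists_geom_sum_eq_two_pow_mul_odd hr4 ho e
  rw [← hN] at hsum
  have hrp : (r : ZMod p) = δ := by rw [hqr, ← hd]; simp [hqp]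
  have hr2 : Odd r := by rw [Nat.odd_iff]; unfold Nat.ModEq at hr4; omega
  obtain ⟨D, rfl⟩ : ∃ D, d = D + 2 := by
    rcases d with _ | _ | D
    · simp at hqr; exact absurd hr.pos (by omega)
    · simp at hqr; exact absurd hr.one_lt (by omega)
    · exact ⟨D, rfl⟩
  have hsize : q * r * (∑ k ∈ Finset.range (N + 2), r ^ k) = 2 ^ e * (q * r * w) := by
    rw [hsum]; ring
  have hzero : ((2 ^ e * (q * r * w) : ℕ) : ZMod p) = 0 := by
    have h1 : (∑ k ∈ Finset.range (N + 2), δ ^ k) * (δ - 1) = 0 := by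
      rw [geom_sum_mul, hδN, sub_self]
    rw [← hsize]
    push_cast
    rw [hrp, (mul_eq_zero.1 h1).resolve_right (sub_ne_zero.2 hδ), mul_zero]
  obtain ⟨A, hA, hrow, hinner⟩ := exists_symmetricDesign hq hr hqr N
    (v := 2 ^ e * (q * r * w) + 1) (by rw [hsize])
  refine ⟨q * r * w, (hqo.mul hr2).mul hw, (ZMod.natCast_eq_zero_iff _ _).1 hzero, ?_,
    fun s k => 2 * A s k - 1, fun s k => ?_, fun s => ?_, fun s t hst => ?_⟩
  · rw [Nat.cast_add, hzero, zero_add, Nat.cast_one]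
  · rcases hA s k with h | h <;> simp [h]
  all_goals
    have hrow' : ∀ s, (∑ k, (A s k : ZMod p)) = 1 := fun s => by
      rw [← Nat.cast_sum, hrow, Nat.cast_pow, hrp, hδN]
    have hcard : ((2 ^ e * (q * r * w) + 1 : ℕ) : ZMod p) = 1 := by
      rw [Nat.cast_add, hzero, zero_add, Nat.cast_one]
  · push_cast
    rw [Finset.sum_sub_distrib, ← Finset.mul_sum, hrow']
    rw [Finset.sum_const, Finset.card_univ, Fintype.card_fin, nsmul_one, hcard]
    ring
  · have hin := congrArg (Nat.cast : ℕ → ZMod p) (hinner s t hst)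
    push_cast at hin
    have hD : ∑ k ∈ Finset.range (D + 1), (q : ZMod p) ^ k = δ - 1 := by
      rw [← hd]; simp [hqp]; ring
    have hδinv : δ ^ (N + 1) = δ⁻¹ := eq_inv_of_mul_eq_one_left (by rw [← pow_succ, hδN])
    have hδ0 : δ ≠ 0 := fun h => by simp [h] at hδN
    rw [hrp, hδinv, hD] at hin
    push_cast
    have hexp : ∀ k, (2 * (A s k : ZMod p) - 1) * (2 * A t k - 1) =
        4 * (A s k * A t k) - 2 * A s k - 2 * A t k + 1 := fun k => by ring
    simp_rw [hexp, Finset.sum_add_distrib, Finset.sum_sub_distrib, ← Finset.mul_sum, hrow', hin]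
    rw [Finset.sum_const, Finset.card_univ, Fintype.card_fin, nsmul_one, hcard]
    field_simp
    ring

/-- If `2 ^ e` divides `n`, then `n` is congruent modulo `2 ^ t` to a small multiple of `2 ^ e * w`. -/
lemma exists_lt_two_pow_dvd_sub {n e w : ℕ} (hw : Odd w) (hn : 2 ^ e ∣ n) (t : ℕ) :
    ∃ s : ℕ, s < 2 ^ t ∧ (2 ^ t : ℤ) ∣ n - s * (2 ^ e * w) := by
  obtain ⟨n', rfl⟩ := hn
  have hcop : Nat.Coprime w (2 ^ t) := (Nat.coprime_two_right.2 hw).pow_right t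
  let u : ZMod (2 ^ t) := n' * (w : ZMod (2 ^ t))⁻¹
  refine ⟨u.val, ZMod.val_lt u, ?_⟩
  have h : (((2 ^ e * n' : ℕ) - u.val * (2 ^ e * w) : ℤ) : ZMod (2 ^ t)) = 0 := by
    push_cast
    rw [ZMod.natCast_zmod_val]
    simp only [u]
    have := ZMod.coe_mul_inv_eq_one w hcop
    linear_combination (-(2 ^ e * n' : ZMod (2 ^ t))) * this
  have := (ZMod.intCast_zmod_eq_zero_iff_dvd _ _).1 h
  exact_mod_cast this

/-- Every large `n` is `2 ^ t M + s (2 ^ e w)` with `2 ^ t ≡ n / 4` and `M ≡ 4 (mod p)`; insert `s`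
blocks of size `2 ^ e w + 1` into the Kronecker product of a Sylvester matrix of order `2 ^ t` and
`J - 2I` of order `M`. -/
lemma existsMH_of_existsPointBlock {p n e w t : ℕ} [Fact p.Prime] (hp2 : p ≠ 2) (hw : Odd w)
    (hpw : p ∣ 2 ^ e * w) (hblock : ExistsPointBlock p n (2 ^ e * w + 1)) (hn : 2 ^ e ∣ n)
    (ht : (2 : ZMod p) ^ t * 4 = n) (hlarge : 2 ^ t + 2 ^ t * (2 ^ e * w) ≤ n) : ExistsMH n p := by
  obtain ⟨s, hs, hdvd⟩ := exists_lt_two_pow_dvd_sub hw hn t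
  have hle : s * (2 ^ e * w) ≤ 2 ^ t * (2 ^ e * w) := Nat.mul_le_mul_right _ hs.le
  obtain ⟨n₀, rfl⟩ : ∃ n₀, n = n₀ + s * (2 ^ e * w) :=
    ⟨n - s * (2 ^ e * w), (Nat.sub_add_cancel (by omega)).symm⟩
  have hcast : ((n₀ + s * (2 ^ e * w) : ℕ) : ZMod p) = n₀ := by
    rw [Nat.cast_add, Nat.cast_mul, (ZMod.natCast_eq_zero_iff _ _).2 hpw, mul_zero, add_zero]
  rw [hcast] at hblock ht
  obtain ⟨M, rfl⟩ : 2 ^ t ∣ n₀ := by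
    have h : ((n₀ + s * (2 ^ e * w) : ℕ) : ℤ) - s * (2 ^ e * w) = n₀ := by push_cast; ring
    rw [h] at hdvd
    exact_mod_cast hdvd
  have h2 : (2 : ZMod p) ≠ 0 := fun h => by
    have : ((2 : ℕ) : ZMod p) = 0 := by exact_mod_cast h
    rw [ZMod.natCast_eq_zero_iff, Nat.prime_dvd_prime_iff_eq Fact.out Nat.prime_two] at this
    exact hp2 this
  have hM : (M : ZMod p) = 4 := by
    push_cast at ht
    exact (mul_left_cancel₀ (pow_ne_zero t h2) ht).symm
  exact ((existsMH_of_cast_eq_four hM).two_pow_mul t).add_mul_of_existsPointBlock hblock (by omega)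

theorem mainTheorem5 (p : ℕ) (hp : p.Prime) (hcond : PrimePowerCondition p)
    (hroot : orderOf (2 : ZMod p) = p - 1)
    (i : ℕ) (hi : 1 ≤ i) (hpi : p ≡ 2 ^ i + 1 [MOD 2 ^ (i + 1)])
    (j : ℕ) (hj : j ≤ i) :
    ∀ᶠ n : ℕ in Filter.cofinite,
      (¬ p ∣ n ∧ ∃ a : ZMod p, 4 * (n : ZMod p)⁻¹ = a ^ (2 ^ j)) →
      2 ^ (i - j) ∣ n →
      ExistsMH n p := by
  have : Fact p.Prime := ⟨hp⟩
  -- `p - 1 = 2 ^ i * o` with `o` odd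
  obtain ⟨o, ho, hpo⟩ : ∃ o, Odd o ∧ p - 1 = 2 ^ i * o := by
    have h1 := Nat.div_add_mod p (2 ^ (i + 1))
    have h2 : p % 2 ^ (i + 1) = 2 ^ i + 1 := by
      rw [hpi, Nat.mod_eq_of_lt]
      have := Nat.one_lt_two_pow (n := i) (by omega)
      rw [pow_succ]; omega
    refine ⟨2 * (p / 2 ^ (i + 1)) + 1, ⟨_, rfl⟩, ?_⟩
    rw [h2] at h1
    have h3 : 2 ^ i * (2 * (p / 2 ^ (i + 1)) + 1) = 2 ^ (i + 1) * (p / 2 ^ (i + 1)) + 2 ^ i := by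
      ring
    omega
  have hp2 : p ≠ 2 := by
    rintro rfl
    have : 2 ∣ 2 ^ i * o := (dvd_pow_self 2 (by omega)).mul_right o
    omega
  have h20 : (2 : ZMod p) ≠ 0 := fun h => by
    rw [h, orderOf_zero] at hroot
    have := hp.two_le
    omega
  have h40 : (4 : ZMod p) ≠ 0 := by
    have := mul_ne_zero h20 h20
    norm_num at this
    exact this
  have hcast {n : ℕ} (hn : ¬ p ∣ n) : (n : ZMod p) ≠ 0 := fun h =>
    hn ((ZMod.natCast_eq_zero_iff _ _).1 h)
  rw [Nat.cofinite_eq_atTop]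
  -- there are finitely many classes `δ = 4 / n`, so that each may be treated on its own
  have key : ∀ a : ZMod p, ∀ᶠ n : ℕ in Filter.atTop, ¬ p ∣ n → 4 * (n : ZMod p)⁻¹ = a ^ (2 ^ j) →
      2 ^ (i - j) ∣ n → ExistsMH n p := fun a => by
    by_cases ha0 : a ^ (2 ^ j) = 0
    · refine Filter.Eventually.of_forall fun n hn h _ => ?_
      rw [ha0] at h
      exact (mul_ne_zero h40 (inv_ne_zero (hcast hn)) h).elim
    by_cases ha1 : a ^ (2 ^ j) = 1
    · refine Filter.Eventually.of_forall fun n hn h _ => existsMH_of_cast_eq_four ?_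
      rw [ha1] at h
      exact (eq_of_mul_inv_eq_one h).symm
    set δ := a ^ (2 ^ j) with hδ
    have hm : 2 ^ j * (2 ^ (i - j) * o) = p - 1 := by
      rw [hpo, ← mul_assoc, ← pow_add, Nat.add_sub_cancel' hj]
    have hδm : δ ^ (2 ^ (i - j) * o) = 1 := by
      rw [hδ, ← pow_mul, hm]
      exact ZMod.pow_card_sub_one_eq_one fun h => ha0 (by rw [hδ, h]; simp)
    obtain ⟨N, hN⟩ : ∃ N, N + 2 = 2 ^ (i - j) * o := by
      refine ⟨2 ^ (i - j) * o - 2, Nat.sub_add_cancel ?_⟩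
      by_contra! h
      have : 0 < 2 ^ (i - j) * o := Nat.mul_pos (by positivity) ho.pos
      have h1 : 2 ^ (i - j) * o = 1 := by omega
      rw [h1, pow_one] at hδm
      exact ha1 hδm
    obtain ⟨q, d, r, hq, hqo, hqp, hd, hr, hrpp, hr4⟩ := hcond δ.val
      (Nat.pos_of_ne_zero fun h => ha0 ((ZMod.val_eq_zero δ).1 h)) (ZMod.val_lt δ)
    rw [← ZMod.natCast_eq_natCast_iff] at hqp hd
    rw [Nat.cast_one] at hqp
    rw [ZMod.natCast_zmod_val] at hd
    rw [← Nat.geomSum_eq hq.two_le] at hr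
    obtain ⟨w, hw, hpw, hblock⟩ := existsPointBlock_of_primePow hq hqo hqp hrpp hr4 hr hd ha1 hN ho
      (hN ▸ hδm)
    -- `2` generates the multiplicative group
    obtain ⟨t, ht⟩ : ∃ t : ℕ, (2 : ZMod p) ^ t = δ⁻¹ := by
      have hprim : IsPrimitiveRoot (2 : ZMod p) (p - 1) := hroot ▸ IsPrimitiveRoot.orderOf 2
      have : NeZero (p - 1) := ⟨by have := hp.two_le; omega⟩
      obtain ⟨t, -, ht⟩ := hprim.eq_pow_of_pow_eq_one
        (ZMod.pow_card_sub_one_eq_one (inv_ne_zero ha0))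
      exact ⟨t, ht⟩
    filter_upwards [Filter.eventually_ge_atTop (2 ^ t + 2 ^ t * (2 ^ (i - j) * w))]
      with n hlarge hn h hdvd
    have hn4 : (n : ZMod p) = 4 * δ⁻¹ := by
      have := hcast hn
      rw [← h]
      field_simp
    rw [← hn4] at hblock
    exact existsMH_of_existsPointBlock hp2 hw hpw hblock hdvd (by rw [ht, hn4, mul_comm]) hlarge
  filter_upwards [Filter.eventually_all.2 key] with n hn h hdvd
  obtain ⟨hpn, a, ha⟩ := h
  exact hn a hpn ha hdvd
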